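/- Let $n\ge 2$. For $f\in L^2(\mathbb R^n)$ whose Fourier transform $\widehat f(\xi)=\int f(x)e^{-2\pi i x\cdot\xi}\,dx$ has compact support, write $$e^{it\Delta}f(x)=\int_{\mathbb R^n}\widehat f(\xi)\,e^{2\pi i x\cdot\xi-4\pi^2 i t|\xi|^2}\,d\xi .$$ There are constants $0<a<b$ and $C>0$, depending only on $n$, such that for every real $s<\frac{n}{2(n+2)}$ there exist positive numbers $R_k\to\infty$ and nonzero functions $v_k\in L^2(\mathbb R^n)$ with $\widehat{v_k}$ supported in the annulus $\{a\le|\xi|\le b\}$ such that $$\lim_{k\to\infty}\frac{\big\|\sup_{0<t<CR_k}|e^{it\Delta}v_k(x)|\big\|_{L^2(B(0,R_k))}}{R_k^{s}\,\|v_k\|_{L^2(\mathbb R^n)}}=\infty .$$ -/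

import Mathlib

open MeasureTheory Filter Topology FourierTransform
open scoped ENNReal

noncomputable section

/-- The Hilbert space `L²(ℝⁿ)` of complex-valued functions. -/
abbrev L2Space (n : ℕ) : Type := Lp (α := EuclideanSpace ℝ (Fin n)) ℂ 2 volume

/-- The Fourier transform of `f ∈ L²(ℝⁿ)` (normalized as `∫ f(x) e^{-2πi x·ξ} dx`) is supported in
the annulus `a ≤ |ξ| ≤ b`. -/
def FourierSupportedInAnnulus {n : ℕ} (f : L2Space n) (a b : ℝ) : Prop :=
  ∀ᵐ ξ : EuclideanSpace ℝ (Fin n), (𝓕 f : L2Space n) ξ ≠ 0 → a ≤ ‖ξ‖ ∧ ‖ξ‖ ≤ b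

/-- The value at the point `x` and the time `t` of the solution of `i ∂ₜ u + Δ u = 0` with initial
data `f`,
`e^{itΔ} f (x) = ∫ 𝓕 f (ξ) e^{2πi x·ξ - 4π² i t |ξ|²} dξ`.
The integral converges absolutely for every `x` and `t` as soon as `𝓕 f` is supported in a bounded
set, see `FourierSupportedInAnnulus.integrable`. -/
def schrodingerFlow {n : ℕ} (f : L2Space n) (t : ℝ) (x : EuclideanSpace ℝ (Fin n)) : ℂ :=
  ∫ ξ : EuclideanSpace ℝ (Fin n), (𝓕 f : L2Space n) ξ *
    Complex.exp (2 * Real.pi * Complex.I * ((inner ℝ x ξ : ℝ) : ℂ)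
      - 4 * Real.pi ^ 2 * Complex.I * t * (‖ξ‖ : ℂ) ^ 2)

/-- The local maximal function `x ↦ sup_{0 < t < τ} |e^{itΔ} f (x)|`, with values in `[0, ∞]`. -/
def schrodingerMaximal {n : ℕ} (f : L2Space n) (τ : ℝ) (x : EuclideanSpace ℝ (Fin n)) : ℝ≥0∞ :=
  ⨆ t ∈ Set.Ioo (0 : ℝ) τ, ‖schrodingerFlow f t x‖ₑ

theorem FourierSupportedInAnnulus.integrable {n : ℕ} {f : L2Space n} {a b : ℝ}
    (hf : FourierSupportedInAnnulus f a b) (t : ℝ) (x : EuclideanSpace ℝ (Fin n)) :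
    Integrable (fun ξ : EuclideanSpace ℝ (Fin n) => (𝓕 f : L2Space n) ξ *
      Complex.exp (2 * Real.pi * Complex.I * ((inner ℝ x ξ : ℝ) : ℂ)
        - 4 * Real.pi ^ 2 * Complex.I * t * (‖ξ‖ : ℂ) ^ 2)) := by
  have h1 : IntegrableOn (fun ξ => (𝓕 f : L2Space n) ξ)
      (Metric.closedBall (0 : EuclideanSpace ℝ (Fin n)) b) := by
    have : IsFiniteMeasure (volume.restrict
        (Metric.closedBall (0 : EuclideanSpace ℝ (Fin n)) b)) :=
      ⟨by simpa using measure_closedBall_lt_top⟩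
    exact ((Lp.memLp (𝓕 f : L2Space n)).restrict _).integrable (by norm_num)
  have h2 : Integrable (fun ξ => (𝓕 f : L2Space n) ξ) := by
    refine (integrable_indicator_iff Metric.isClosed_closedBall.measurableSet).2 h1 |>.congr ?_
    filter_upwards [hf] with ξ hξ
    by_cases h : (𝓕 f : L2Space n) ξ = 0
    · simp [Set.indicator, h]
    · simp [Set.indicator, (hξ h).2]
  refine h2.mul_bdd (c := 1) (by fun_prop) (ae_of_all _ fun ξ => ?_)
  rw [Complex.norm_exp]
  simp [← Complex.ofReal_pow]

end

open MeasureTheory Filter Topology FourierTransform Set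

/-! The data `v` has Fourier transform the indicator of a set `E` on which, for every `x` in the
ball, some time makes all phases nearly equal modulo one. Then the maximal function is at least `|E|
/ 2` on the whole ball, while `‖v‖ = |E| ^ (1/2)`.

Coordinate `i` of `E` ranges over intervals of length `δ` starting at `ζ = (q + k + θ / 2) / q`, `k
< N`, with `θ = q ^ (-(i + 1))`. At `2πt = j q ^ 2` the phase `x ζ - j q ^ 2 ζ ^ 2` equals `(q + k)
(x / q - j θ)` up to an integer and a term free of `k`. One `j ≤ q ^ n` puts every `x i / q - j θ`
within `1 / q` of an integer, since the `θ` read off successive base-`q` digits of `j`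
(`exists_pos_nat_le_pow_approx`). With `q = K N` the dependence on `k` is at most `1 / K`
(`exists_phase_approx`).

With `R = q ^ (n + 2)`, `δ = 1 / (K R)`, we get `|E| R ^ n = (N / K) ^ n`, so the ratio is at least
a constant times `N ^ (n / 2 - (n + 2) s)`. -/

/-! ### Simultaneous approximation by base-`q` digits -/

/-- In base `q`, one integer `j < q ^ n` approximates `n` prescribed reals modulo one through its
leading digits `j / q ^ (i + 1)`. -/
theorem exists_nat_lt_pow_approx {q : ℕ} (hq : 0 < q) (y : ℕ → ℝ) (n : ℕ) :
    ∃ j : ℕ, j < q ^ n ∧ ∀ i < n, ∃ p : ℤ, |y i - j * (1 / (q : ℝ) ^ (i + 1)) - p| ≤ 1 / q := by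
  have hq' : (0 : ℝ) < q := by exact_mod_cast hq
  induction n with
  | zero => exact ⟨0, by simp, by simp⟩
  | succ n ih =>
    obtain ⟨j, hj, h⟩ := ih
    set u : ℝ := Int.fract (y n) * q with hu
    have hu0 : 0 ≤ u := mul_nonneg (Int.fract_nonneg _) hq'.le
    have huq : u < q := by
      have := mul_lt_mul_of_pos_right (Int.fract_lt_one (y n)) hq'
      simpa [hu] using this
    have hd1 := Nat.floor_le hu0
    have hd2 := Nat.lt_floor_add_one u
    have hdq : ⌊u⌋₊ < q := (Nat.floor_lt hu0).2 huq
    set d : ℕ := ⌊u⌋₊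
    -- The new top digit `d` changes the earlier `j / q ^ (i + 1)` only by integers.
    refine ⟨j + d * q ^ n, ?_, fun i hi => ?_⟩
    · calc j + d * q ^ n < q ^ n + d * q ^ n := by omega
        _ = (d + 1) * q ^ n := by ring
        _ ≤ q * q ^ n := Nat.mul_le_mul_right _ hdq
        _ = q ^ (n + 1) := by ring
    · rcases Nat.lt_succ_iff_lt_or_eq.1 hi with hi | rfl
      · obtain ⟨p, hp⟩ := h i hi
        obtain ⟨m, rfl⟩ := Nat.exists_eq_add_of_lt hi
        refine ⟨p - d * q ^ m, ?_⟩
        convert hp using 2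
        push_cast
        field_simp
        ring
      · refine ⟨⌊y i⌋, ?_⟩
        have hj' : (j : ℝ) < (q : ℝ) ^ i := by exact_mod_cast hj
        have e : y i - ((j + d * q ^ i : ℕ) : ℝ) * (1 / (q : ℝ) ^ (i + 1)) - ⌊y i⌋
            = (u - d - j / (q : ℝ) ^ i) / q := by
          rw [hu, Int.fract]
          push_cast
          field_simp
          ring
        have h1 : (j : ℝ) / (q : ℝ) ^ i < 1 := (div_lt_one (by positivity)).2 hj'
        have h0 : 0 ≤ (j : ℝ) / (q : ℝ) ^ i := by positivity
        rw [e, abs_div, abs_of_pos hq']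
        gcongr
        rw [abs_le]
        constructor <;> linarith

theorem exists_pos_nat_le_pow_approx {q : ℕ} (hq : 0 < q) (n : ℕ) (y : Fin n → ℝ) :
    ∃ j : ℕ, 0 < j ∧ j ≤ q ^ n ∧
      ∀ i : Fin n, ∃ p : ℤ, |y i - j * (1 / (q : ℝ) ^ (i.1 + 1)) - p| ≤ 1 / q := by
  -- Shifting the targets by one step `θ` trades `j` for `j + 1`, which is positive and so gives a
  -- positive time.
  obtain ⟨j, hj, h⟩ := exists_nat_lt_pow_approx hq
    (fun i => if h : i < n then y ⟨i, h⟩ - 1 / (q : ℝ) ^ (i + 1) else 0) n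
  refine ⟨j + 1, by omega, by omega, fun i => ?_⟩
  obtain ⟨p, hp⟩ := h i i.2
  refine ⟨p, ?_⟩
  simp only [i.2, dite_true] at hp
  convert hp using 2
  push_cast
  ring

/-! ### One-dimensional frequency combs and their phases -/

/-- The union of the `N` intervals of length `δ` starting at `1 + (k + θ / 2) / q`, `k < N`. -/
def frequencyComb (q N : ℕ) (θ δ : ℝ) : Set ℝ :=
  ⋃ k ∈ Finset.range N, Ico (1 + (k + θ / 2) / q) (1 + (k + θ / 2) / q + δ)

theorem mem_frequencyComb {q N : ℕ} {θ δ ξ : ℝ} : ξ ∈ frequencyComb q N θ δ ↔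
    ∃ k < N, 1 + (k + θ / 2) / q ≤ ξ ∧ ξ < 1 + (k + θ / 2) / q + δ := by
  simp only [frequencyComb, mem_iUnion, Finset.mem_range, mem_Ico, exists_prop]

theorem measurableSet_frequencyComb (q N : ℕ) (θ δ : ℝ) :
    MeasurableSet (frequencyComb q N θ δ) :=
  Finset.measurableSet_biUnion _ fun _ _ => measurableSet_Ico

theorem volume_frequencyComb {q : ℕ} (N : ℕ) (θ : ℝ) {δ : ℝ} (hδ : δ ≤ 1 / q) :
    volume (frequencyComb q N θ δ) = N * ENNReal.ofReal δ := by
  have key : ∀ k l : ℕ, k < l →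
      Disjoint (Ico (1 + (k + θ / 2) / q : ℝ) (1 + (k + θ / 2) / q + δ))
        (Ico (1 + (l + θ / 2) / q) (1 + (l + θ / 2) / q + δ)) := by
    intro k l hkl
    rw [Set.disjoint_left]
    rintro ξ ⟨_, h1⟩ ⟨h2, _⟩
    have hkl' : (k : ℝ) + 1 ≤ l := by exact_mod_cast hkl
    have : (k + 1 + θ / 2) / (q : ℝ) ≤ (l + θ / 2) / q := by gcongr
    have e : (k + 1 + θ / 2) / (q : ℝ) = (k + θ / 2) / q + 1 / q := by ring
    linarith
  rw [frequencyComb, measure_biUnion_finset]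
  · simp
  · intro k _ l _ hkl
    rcases lt_or_gt_of_ne hkl with h | h
    · exact key k l h
    · exact (key l k h).symm
  · exact fun _ _ => measurableSet_Ico

theorem frequencyComb_subset {q N : ℕ} {θ δ : ℝ} (hq : 0 < q) (hN : N ≤ q) (hθ0 : 0 ≤ θ)
    (hθ1 : θ ≤ 1) (hδ : δ ≤ 1 / q) : frequencyComb q N θ δ ⊆ Icc 1 3 := by
  intro ξ hξ
  obtain ⟨k, hk, h1, h2⟩ := mem_frequencyComb.1 hξ
  have hq' : (0 : ℝ) < q := by exact_mod_cast hq
  have hk' : (k : ℝ) + 1 ≤ q := by exact_mod_cast hk.trans_le hN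
  have h3 : 0 ≤ (k + θ / 2) / (q : ℝ) := by positivity
  have h4 : (k + θ / 2) / (q : ℝ) + 1 / q ≤ 2 := by
    rw [← add_div, div_le_iff₀ hq']
    have : (1 : ℝ) ≤ q := by exact_mod_cast hq
    linarith
  exact ⟨by linarith, by linarith⟩

/-- Squaring doubles the offset `θ / 2`, producing the cross term `j θ (q + k)` that corrects `x (q
+ k) / q`. The error `8 / K` is `1 / K` from `k r`, `1 / K` from `x (ξ - ζ)` and `6 / K` from the
quadratic term, as `ξ + ζ ≤ 6`. -/
theorem exists_phase_approx {q N : ℕ} {θ δ K R x r : ℝ} {j : ℕ} {p : ℤ} (hq : 0 < q)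
    (hK : 1 ≤ K) (hqK : (q : ℝ) = K * N) (hθ0 : 0 ≤ θ) (hθ1 : θ ≤ 1) (hδ : δ ≤ 1 / q)
    (hδR : K * (R * δ) = 1) (hx : |x| ≤ R) (hj : j * (q : ℝ) ^ 2 ≤ R)
    (hr : x / q - j * θ - p = r) (hr' : |r| ≤ 1 / q) :
    ∃ c : ℝ, ∀ ξ ∈ frequencyComb q N θ δ, ∃ z : ℤ,
      |x * ξ - j * (q : ℝ) ^ 2 * ξ ^ 2 - c - z| ≤ 8 / K := by
  have hq' : (0 : ℝ) < q := by exact_mod_cast hq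
  have hK0 : 0 < K := by linarith
  have hNq : N ≤ q := by
    have : (N : ℝ) ≤ q := by rw [hqK]; exact le_mul_of_one_le_left (by positivity) hK
    exact_mod_cast this
  -- These are the terms of the phase at `ζ` that are independent of `k`.
  refine ⟨q * r + x * θ / (2 * q) - j * θ ^ 2 / 4, fun ξ hξ => ?_⟩
  have hξ3 := frequencyComb_subset hq hNq hθ0 hθ1 hδ hξ
  obtain ⟨k, hk, h1, h2⟩ := mem_frequencyComb.1 hξ
  refine ⟨(q + k) * p - j * (q + k) ^ 2, ?_⟩
  set ζ : ℝ := 1 + (k + θ / 2) / q with hζ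
  have hζ1 : 1 ≤ ζ := by
    have : 0 ≤ (k + θ / 2) / (q : ℝ) := by positivity
    linarith
  have hR0 : 0 ≤ R := (abs_nonneg x).trans hx
  have e : x * ξ - j * (q : ℝ) ^ 2 * ξ ^ 2 - (q * r + x * θ / (2 * q) - j * θ ^ 2 / 4)
      - (((q + k) * p - j * (q + k) ^ 2 : ℤ) : ℝ)
      = k * r + x * (ξ - ζ) - (j * (q : ℝ) ^ 2) * ((ξ - ζ) * (ξ + ζ)) := by
    have e1 : x * ζ - j * (q : ℝ) ^ 2 * ζ ^ 2
        = (q + k) * (r + p) - j * (q + k) ^ 2 + x * θ / (2 * q) - j * θ ^ 2 / 4 := by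
      rw [hζ, ← hr]
      field_simp
      ring
    push_cast
    linear_combination e1
  have b1 : |k * r| ≤ 1 / K := by
    rw [abs_mul, Nat.abs_cast]
    calc (k : ℝ) * |r| ≤ N * (1 / q) := by gcongr
      _ = 1 / K := by
        have hN : (N : ℝ) ≠ 0 := by rintro h; rw [h, mul_zero] at hqK; exact hq'.ne' hqK
        rw [hqK]; field_simp
  have hRδ : R * δ = 1 / K := by field_simp; linarith
  have hd0 : 0 ≤ ξ - ζ := by linarith
  have hd1 : ξ - ζ ≤ δ := by linarith
  have b2 : |x * (ξ - ζ)| ≤ 1 / K := by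
    rw [abs_mul, abs_of_nonneg hd0, ← hRδ]
    gcongr
  have b3 : |(j * (q : ℝ) ^ 2) * ((ξ - ζ) * (ξ + ζ))| ≤ 6 * (1 / K) := by
    have hs : 0 ≤ ξ + ζ := by linarith
    rw [abs_of_nonneg (by positivity), ← hRδ]
    calc (j * (q : ℝ) ^ 2) * ((ξ - ζ) * (ξ + ζ)) ≤ R * (δ * 6) := by
          have : ξ + ζ ≤ 6 := by linarith [hξ3.2]
          have hδ0 : 0 ≤ δ := hd0.trans hd1
          gcongr
      _ = 6 * (R * δ) := by ring
  rw [e]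
  have t1 := abs_sub (k * r + x * (ξ - ζ)) ((j * (q : ℝ) ^ 2) * ((ξ - ζ) * (ξ + ζ)))
  have t2 := abs_add_le (k * r) (x * (ξ - ζ))
  have : 8 / K = 8 * (1 / K) := by ring
  linarith

/-! ### Absence of cancellation for nearly constant phases -/

theorem half_measureReal_le_norm_setIntegral {α : Type*} [MeasurableSpace α] {μ : Measure α}
    {E : Set α} (hE : MeasurableSet E) (hμ : μ E ≠ ∞) {F : α → ℂ} (hF : IntegrableOn F E μ) {w : ℂ}
    (hw : ‖w‖ = 1) (h : ∀ ξ ∈ E, 1 / 2 ≤ (w * F ξ).re) :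
    μ.real E / 2 ≤ ‖∫ ξ in E, F ξ ∂μ‖ := by
  calc μ.real E / 2 = ∫ _ in E, (1 / 2 : ℝ) ∂μ := by simp; ring
    _ ≤ ∫ ξ in E, (w * F ξ).re ∂μ :=
        setIntegral_mono_on (by simp [hμ.lt_top]) (hF.const_mul w).re hE h
    _ = (∫ ξ in E, w * F ξ ∂μ).re := integral_re (hF.const_mul w)
    _ ≤ ‖∫ ξ in E, w * F ξ ∂μ‖ := Complex.re_le_norm _
    _ = ‖∫ ξ in E, F ξ ∂μ‖ := by
      rw [integral_const_mul, norm_mul, hw, one_mul]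

theorem half_le_re_exp_mul_exp {P c : ℝ} {z : ℤ} (h : |P - c - z| ≤ 1 / 8) :
    1 / 2 ≤ (Complex.exp ((-(2 * Real.pi * c) : ℝ) * Complex.I)
      * Complex.exp ((2 * Real.pi * P : ℝ) * Complex.I)).re := by
  rw [← Complex.exp_add, ← add_mul, ← Complex.ofReal_add, Complex.exp_ofReal_mul_I_re]
  have e : -(2 * Real.pi * c) + 2 * Real.pi * P
      = 2 * Real.pi * (P - c - z) + z * (2 * Real.pi) := by ring
  rw [e, Real.cos_add_int_mul_two_pi]
  have h1 : |2 * Real.pi * (P - c - z)| ≤ 1 := by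
    rw [abs_mul, abs_of_pos Real.two_pi_pos]
    have := mul_le_mul_of_nonneg_left h Real.two_pi_pos.le
    linarith [Real.pi_lt_four]
  have h2 := (sq_le_one_iff_abs_le_one _).2 h1
  linarith [Real.one_sub_sq_div_two_le_cos (x := 2 * Real.pi * (P - c - z))]

/-! ### The frequency set and data with indicator Fourier transform -/

/-- The set of frequencies whose `i`-th coordinate lies in the comb with `θ = 1 / q ^ (i + 1)`. -/
def frequencySet (n q N : ℕ) (δ : ℝ) : Set (EuclideanSpace ℝ (Fin n)) :=
  {ξ | ∀ i : Fin n, ξ i ∈ frequencyComb q N (1 / (q : ℝ) ^ (i.1 + 1)) δ}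

theorem frequencySet_eq_preimage (n q N : ℕ) (δ : ℝ) :
    frequencySet n q N δ = (WithLp.ofLp : EuclideanSpace ℝ (Fin n) → Fin n → ℝ) ⁻¹'
      univ.pi fun i : Fin n => frequencyComb q N (1 / (q : ℝ) ^ (i.1 + 1)) δ := by
  ext ξ
  simp [frequencySet]

theorem measurableSet_frequencySet (n q N : ℕ) (δ : ℝ) :
    MeasurableSet (frequencySet n q N δ) := by
  rw [frequencySet_eq_preimage]
  exact (PiLp.volume_preserving_ofLp (Fin n)).measurable
    (MeasurableSet.univ_pi fun i => measurableSet_frequencyComb _ _ _ _)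

theorem volume_frequencySet (n : ℕ) {q : ℕ} (N : ℕ) {δ : ℝ} (hδ : δ ≤ 1 / q) :
    volume (frequencySet n q N δ) = (N * ENNReal.ofReal δ) ^ n := by
  rw [frequencySet_eq_preimage, (PiLp.volume_preserving_ofLp (Fin n)).measure_preimage
    (MeasurableSet.univ_pi fun i => measurableSet_frequencyComb _ _ _ _).nullMeasurableSet,
    volume_pi_pi]
  simp [volume_frequencyComb N _ hδ]

theorem measureReal_frequencySet (n : ℕ) {q : ℕ} (N : ℕ) {δ : ℝ} (hδ0 : 0 ≤ δ) (hδ : δ ≤ 1 / q) :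
    volume.real (frequencySet n q N δ) = (N * δ) ^ n := by
  simp [measureReal_def, volume_frequencySet n N hδ, hδ0]

theorem norm_mem_Icc_of_mem_frequencySet {n q N : ℕ} {δ : ℝ} (hn : 0 < n) (hq : 0 < q)
    (hN : N ≤ q) (hδ : δ ≤ 1 / q) {ξ : EuclideanSpace ℝ (Fin n)} (hξ : ξ ∈ frequencySet n q N δ) :
    1 ≤ ‖ξ‖ ∧ ‖ξ‖ ≤ 3 * n := by
  have hq1 : (1 : ℝ) ≤ q := by exact_mod_cast hq
  have h : ∀ i, ξ i ∈ Icc (1 : ℝ) 3 := fun i =>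
    frequencyComb_subset hq hN (by positivity) (by
      rw [div_le_one (by positivity)]
      exact one_le_pow₀ hq1) hδ (hξ i)
  constructor
  · have h1 := PiLp.norm_apply_le ξ ⟨0, hn⟩
    have h2 := (h ⟨0, hn⟩).1
    rw [Real.norm_of_nonneg (by linarith)] at h1
    linarith
  · have hn1 : (1 : ℝ) ≤ n := by exact_mod_cast hn
    have h1 : ‖ξ‖ ^ 2 ≤ (3 * n) ^ 2 := by
      rw [EuclideanSpace.norm_sq_eq]
      calc ∑ i, ‖ξ i‖ ^ 2 ≤ ∑ _i : Fin n, (3 : ℝ) ^ 2 := by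
            gcongr with i
            rw [Real.norm_of_nonneg (by linarith [(h i).1])]
            exact (h i).2
        _ = 9 * n := by simp; ring
        _ ≤ (3 * n) ^ 2 := by nlinarith
    exact (pow_le_pow_iff_left₀ (norm_nonneg _) (by positivity) two_ne_zero).1 h1

/-- The function in `L²` whose Fourier transform is the indicator function of `E`. -/
noncomputable def bandLimitedFun {n : ℕ} {E : Set (EuclideanSpace ℝ (Fin n))} (hE : MeasurableSet E)
    (hμ : volume E ≠ ∞) : L2Space n :=
  𝓕⁻ (indicatorConstLp 2 hE hμ (1 : ℂ) : L2Space n)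

section BandLimited

variable {n : ℕ} {E : Set (EuclideanSpace ℝ (Fin n))} (hE : MeasurableSet E) (hμ : volume E ≠ ∞)

theorem fourier_bandLimitedFun :
    (𝓕 (bandLimitedFun hE hμ) : L2Space n) = indicatorConstLp 2 hE hμ (1 : ℂ) :=
  FourierTransform.fourier_fourierInv_eq _

theorem norm_bandLimitedFun : ‖bandLimitedFun hE hμ‖ = Real.sqrt (volume.real E) := by
  rw [← Lp.norm_fourier_eq, fourier_bandLimitedFun, norm_indicatorConstLp (by simp) (by simp)]
  simp [Real.sqrt_eq_rpow]

theorem fourierSupportedInAnnulus_bandLimitedFun {a b : ℝ} (h : ∀ ξ ∈ E, a ≤ ‖ξ‖ ∧ ‖ξ‖ ≤ b) :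
    FourierSupportedInAnnulus (bandLimitedFun hE hμ) a b := by
  unfold FourierSupportedInAnnulus
  rw [fourier_bandLimitedFun]
  filter_upwards [indicatorConstLp_coeFn_notMem (p := 2) (hs := hE) (hμs := hμ) (c := (1 : ℂ))]
    with ξ hξ h0
  by_contra hc
  exact h0 (hξ fun hm => hc (h ξ hm))

theorem schrodingerFlow_bandLimitedFun (t : ℝ) (x : EuclideanSpace ℝ (Fin n)) :
    schrodingerFlow (bandLimitedFun hE hμ) t x = ∫ ξ in E,
      Complex.exp ((2 * Real.pi * (∑ i, (x i * ξ i - 2 * Real.pi * t * ξ i ^ 2)) : ℝ)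
        * Complex.I) := by
  rw [schrodingerFlow, fourier_bandLimitedFun, ← integral_indicator hE]
  refine integral_congr_ae ?_
  filter_upwards [indicatorConstLp_coeFn (p := 2) (hs := hE) (hμs := hμ) (c := (1 : ℂ))] with ξ hξ
  rw [hξ]
  by_cases hm : ξ ∈ E
  · rw [indicator_of_mem hm, indicator_of_mem hm, one_mul]
    congr 1
    rw [← Complex.ofReal_pow ‖ξ‖, EuclideanSpace.norm_sq_eq, Finset.sum_sub_distrib, ← Finset.mul_sum,
      PiLp.inner_apply]
    simp only [Real.norm_eq_abs, sq_abs]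
    have : ∑ i, inner ℝ (x i) (ξ i) = ∑ i, x i * ξ i := by simp [mul_comm]
    rw [this]
    push_cast
    ring
  · simp [hm]

theorem half_measureReal_le_norm_schrodingerFlow {t c : ℝ} {x : EuclideanSpace ℝ (Fin n)}
    (h : ∀ ξ ∈ E, ∃ z : ℤ, |∑ i, (x i * ξ i - 2 * Real.pi * t * ξ i ^ 2) - c - z| ≤ 1 / 8) :
    volume.real E / 2 ≤ ‖schrodingerFlow (bandLimitedFun hE hμ) t x‖ := by
  rw [schrodingerFlow_bandLimitedFun]
  refine half_measureReal_le_norm_setIntegral hE hμ ?_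
    (w := Complex.exp ((-(2 * Real.pi * c) : ℝ) * Complex.I)) (Complex.norm_exp_ofReal_mul_I _)
    fun ξ hξ => ?_
  · have : IsFiniteMeasure (volume.restrict E) := ⟨by simpa using hμ.lt_top⟩
    refine Integrable.of_bound (C := 1) (Continuous.aestronglyMeasurable (by fun_prop))
      (ae_of_all _ fun ξ => (Complex.norm_exp_ofReal_mul_I _).le)
  · obtain ⟨z, hz⟩ := h ξ hξ
    exact half_le_re_exp_mul_exp hz

end BandLimited

/-! ### Lower bound for the maximal function -/

theorem exists_half_measureReal_le_norm_schrodingerFlow {n q N : ℕ} {δ R K : ℝ} (hn : 0 < n)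
    (hq : 0 < q) (hK : K = 64 * n) (hqK : (q : ℝ) = K * N) (hR : R = (q : ℝ) ^ (n + 2))
    (hδ : δ ≤ 1 / q) (hδR : K * (R * δ) = 1) (hμ : volume (frequencySet n q N δ) ≠ ∞)
    {x : EuclideanSpace ℝ (Fin n)} (hx : ‖x‖ ≤ R) :
    ∃ t ∈ Ioo 0 R, volume.real (frequencySet n q N δ) / 2 ≤
      ‖schrodingerFlow (bandLimitedFun (measurableSet_frequencySet n q N δ) hμ) t x‖ := by
  have hq' : (0 : ℝ) < q := by exact_mod_cast hq
  have hq1 : (1 : ℝ) ≤ q := by exact_mod_cast hq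
  have hn1 : (1 : ℝ) ≤ n := by exact_mod_cast hn
  have hR0 : 0 < R := by rw [hR]; positivity
  obtain ⟨j, hj0, hj, happ⟩ := exists_pos_nat_le_pow_approx hq n fun i => x i / q
  have hj0' : (0 : ℝ) < j := by exact_mod_cast hj0
  have hjR : (j : ℝ) * (q : ℝ) ^ 2 ≤ R := by
    rw [hR, pow_add]
    gcongr
    exact_mod_cast hj
  have hphase : ∀ i : Fin n, ∃ c : ℝ, ∀ ξ ∈ frequencyComb q N (1 / (q : ℝ) ^ (i.1 + 1)) δ,
      ∃ z : ℤ, |x i * ξ - j * (q : ℝ) ^ 2 * ξ ^ 2 - c - z| ≤ 8 / K := by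
    intro i
    obtain ⟨p, hp⟩ := happ i
    refine exists_phase_approx hq (by linarith) hqK (by positivity) ?_ hδ hδR
      ((PiLp.norm_apply_le x i).trans hx) hjR rfl hp
    rw [div_le_one (by positivity)]
    exact one_le_pow₀ hq1
  choose c hc using hphase
  have ht : 2 * Real.pi * (j * (q : ℝ) ^ 2 / (2 * Real.pi)) = j * (q : ℝ) ^ 2 := by
    field_simp
  refine ⟨j * (q : ℝ) ^ 2 / (2 * Real.pi), ⟨by positivity, ?_⟩,
    half_measureReal_le_norm_schrodingerFlow _ hμ (c := ∑ i, c i) fun ξ hξ => ?_⟩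
  · rw [div_lt_iff₀ Real.two_pi_pos]
    nlinarith [Real.pi_gt_three]
  · choose z hz using fun i => hc i (ξ i) (hξ i)
    refine ⟨∑ i, z i, ?_⟩
    simp only [ht]
    push_cast
    rw [← Finset.sum_sub_distrib, ← Finset.sum_sub_distrib]
    calc _ ≤ ∑ i, |x i * ξ i - j * (q : ℝ) ^ 2 * ξ i ^ 2 - c i - z i| :=
          Finset.abs_sum_le_sum_abs _ _
      _ ≤ ∑ _i : Fin n, 8 / K := Finset.sum_le_sum fun i _ => hz i
      -- `K = 64 n` is chosen so that `n` coordinate errors of `8 / K` total `1 / 8`.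
      _ = 1 / 8 := by
        simp only [Finset.sum_const, Finset.card_univ, Fintype.card_fin, nsmul_eq_mul]
        rw [hK]
        field_simp
        norm_num

theorem ofReal_le_eLpNorm_restrict {α : Type*} [MeasurableSpace α] {μ : Measure α} {B : Set α}
    (hB : MeasurableSet B) (hμ : μ B ≠ ∞) {g : α → ℝ≥0∞} {m : ℝ} (hm : 0 ≤ m)
    (h : ∀ x ∈ B, ENNReal.ofReal m ≤ g x) :
    ENNReal.ofReal (m * Real.sqrt (μ.real B)) ≤ eLpNorm g 2 (μ.restrict B) := by
  calc ENNReal.ofReal (m * Real.sqrt (μ.real B))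
      = eLpNorm (fun _ : α => ENNReal.ofReal m) 2 (μ.restrict B) := by
        rw [eLpNorm_const' _ two_ne_zero ENNReal.ofNat_ne_top, ENNReal.ofReal_mul hm,
          Real.sqrt_eq_rpow, ← ENNReal.ofReal_rpow_of_nonneg measureReal_nonneg (by norm_num),
          ofReal_measureReal hμ]
        simp
    _ ≤ _ := by
        refine eLpNorm_mono_enorm_ae ?_
        filter_upwards [ae_restrict_mem hB] with x hx
        simpa using h x hx

theorem exists_maximal_ratio_ge {n : ℕ} (hn : 0 < n) (s : ℝ) (N : ℕ) (hN : 0 < N) :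
    ∃ v : L2Space n, v ≠ 0 ∧ FourierSupportedInAnnulus v 1 (3 * n) ∧
      ENNReal.ofReal (Real.sqrt (volume.real (Metric.ball (0 : EuclideanSpace ℝ (Fin n)) 1)) / 2 *
          Real.sqrt ((N / (64 * n)) ^ n) / ((64 * n * N : ℝ) ^ (n + 2)) ^ s) ≤
        eLpNorm (schrodingerMaximal v ((64 * n * N : ℝ) ^ (n + 2))) 2
          (volume.restrict (Metric.ball (0 : EuclideanSpace ℝ (Fin n))
            ((64 * n * N : ℝ) ^ (n + 2)))) /
          ENNReal.ofReal (((64 * n * N : ℝ) ^ (n + 2)) ^ s * ‖v‖) := by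
  have hn' : (1 : ℝ) ≤ n := by exact_mod_cast hn
  have hN' : (1 : ℝ) ≤ N := by exact_mod_cast hN
  obtain ⟨q, hqdef⟩ : ∃ q : ℕ, q = 64 * n * N := ⟨_, rfl⟩
  obtain ⟨K, hK⟩ : ∃ K : ℝ, K = 64 * n := ⟨_, rfl⟩
  have hqK : (q : ℝ) = K * N := by rw [hqdef, hK]; push_cast; ring
  have hK1 : 1 ≤ K := by linarith
  have hNq : N ≤ q := by rw [hqdef]; exact Nat.le_mul_of_pos_left _ (by omega)
  have hq : 0 < q := hN.trans_le hNq
  have hq1 : (1 : ℝ) ≤ q := by exact_mod_cast hq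
  rw [← hK, ← hqK]
  obtain ⟨R, hR⟩ : ∃ R : ℝ, R = (q : ℝ) ^ (n + 2) := ⟨_, rfl⟩
  rw [← hR]
  have hqR : (q : ℝ) ≤ R := by rw [hR]; exact le_self_pow₀ hq1 (by omega)
  have hR0 : 0 < R := by linarith
  have hK0 : 0 < K := by linarith
  obtain ⟨δ, hδdef⟩ : ∃ δ : ℝ, δ = 1 / (K * R) := ⟨_, rfl⟩
  have hδ0 : 0 < δ := by rw [hδdef]; positivity
  have hδ : δ ≤ 1 / q := by
    rw [hδdef]
    exact one_div_le_one_div_of_le (by linarith) (hqR.trans (le_mul_of_one_le_left hR0.le hK1))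
  have hδR : K * (R * δ) = 1 := by rw [hδdef]; field_simp
  have hM := measureReal_frequencySet n N hδ0.le hδ
  have hμ : volume (frequencySet n q N δ) ≠ ∞ := by
    rw [volume_frequencySet n N hδ]
    exact ENNReal.pow_ne_top (ENNReal.mul_ne_top (by simp) (by simp))
  set M := volume.real (frequencySet n q N δ) with hMdef
  have hM0 : 0 < M := by rw [hM]; positivity
  have hsM : 0 < Real.sqrt M := Real.sqrt_pos.2 hM0
  set v := bandLimitedFun (measurableSet_frequencySet n q N δ) hμ with hv
  have hvn : ‖v‖ = Real.sqrt M := norm_bandLimitedFun _ _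
  refine ⟨v, ?_, ?_, ?_⟩
  · rw [← norm_pos_iff, hvn]
    exact hsM
  · exact fourierSupportedInAnnulus_bandLimitedFun _ _ fun ξ hξ =>
      norm_mem_Icc_of_mem_frequencySet hn hq hNq hδ hξ
  · have hmax : ∀ x ∈ Metric.ball (0 : EuclideanSpace ℝ (Fin n)) R,
        ENNReal.ofReal (M / 2) ≤ schrodingerMaximal v R x := by
      intro x hx
      obtain ⟨t, ht, hle⟩ := exists_half_measureReal_le_norm_schrodingerFlow hn hq hK hqK hR hδ hδR
        hμ (x := x) (mem_ball_zero_iff.1 hx).le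
      calc ENNReal.ofReal (M / 2) ≤ ENNReal.ofReal ‖schrodingerFlow v t x‖ :=
            ENNReal.ofReal_le_ofReal hle
        _ = ‖schrodingerFlow v t x‖ₑ := ofReal_norm _
        _ ≤ _ := le_iSup₂ (f := fun t (_ : t ∈ Ioo (0 : ℝ) R) => ‖schrodingerFlow v t x‖ₑ) t ht
    have hlow := ofReal_le_eLpNorm_restrict (μ := volume) Metric.isOpen_ball.measurableSet
      Metric.isBounded_ball.measure_lt_top.ne (by positivity) hmax
    refine le_trans ?_ (ENNReal.div_le_div_right hlow _)
    have hRs : 0 < R ^ s := Real.rpow_pos_of_pos hR0 s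
    rw [← ENNReal.ofReal_div_of_pos (by rw [hvn]; positivity)]
    refine ENNReal.ofReal_le_ofReal (le_of_eq ?_)
    have hW : volume.real (Metric.ball (0 : EuclideanSpace ℝ (Fin n)) R)
        = R ^ n * volume.real (Metric.ball (0 : EuclideanSpace ℝ (Fin n)) 1) := by
      rw [measureReal_def, Measure.addHaar_ball_of_pos volume _ hR0, ENNReal.toReal_mul,
        ENNReal.toReal_ofReal (by positivity), finrank_euclideanSpace_fin, measureReal_def]
    have hMR : (N / K) ^ n = M * R ^ n := by
      rw [hM, ← mul_pow]
      congr 1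
      rw [hδdef]
      field_simp
    rw [hvn, hW, hMR, Real.sqrt_mul hM0.le, Real.sqrt_mul (by positivity)]
    have hMs : M = Real.sqrt M * Real.sqrt M := (Real.mul_self_sqrt hM0.le).symm
    rw [div_eq_div_iff hRs.ne' (by positivity)]
    linear_combination (Real.sqrt (R ^ n) *
      Real.sqrt (volume.real (Metric.ball (0 : EuclideanSpace ℝ (Fin n)) 1)) * R ^ s / 2) * hMs.symm

/-! ### Divergence of the ratio -/

theorem tendsto_maximal_ratio_lower_bound {n : ℕ} (hn : 0 < n) {s W : ℝ} (hW : 0 < W)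
    (hs : s < (n : ℝ) / (2 * ((n : ℝ) + 2))) :
    Tendsto (fun k : ℕ => W / 2 * Real.sqrt (((k + 1 : ℕ) / (64 * n)) ^ n) /
      ((64 * n * (k + 1 : ℕ) : ℝ) ^ (n + 2)) ^ s) atTop atTop := by
  have hn' : (0 : ℝ) < n := by exact_mod_cast hn
  have hexp : 0 < (n : ℝ) / 2 - (n + 2) * s := by
    rw [lt_div_iff₀ (by positivity)] at hs
    linarith
  have hlim : Tendsto (fun k : ℕ => W / 2 * Real.sqrt ((1 / (64 * n : ℝ)) ^ n) /
      ((64 * n : ℝ) ^ (n + 2)) ^ s * ((k + 1 : ℕ) : ℝ) ^ ((n : ℝ) / 2 - (n + 2) * s))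
      atTop atTop := by
    refine Tendsto.const_mul_atTop (by positivity) ?_
    exact (tendsto_rpow_atTop hexp).comp
      (tendsto_natCast_atTop_atTop.comp (tendsto_add_atTop_nat 1))
  refine hlim.congr fun k => ?_
  have hk : (0 : ℝ) < ((k + 1 : ℕ) : ℝ) := by positivity
  generalize ((k + 1 : ℕ) : ℝ) = y at hk
  have e1 : (y / (64 * n)) ^ n = (1 / (64 * n : ℝ)) ^ n * y ^ n := by
    rw [← mul_pow]; congr 1; ring
  have e2 : Real.sqrt (y ^ n) = y ^ ((n : ℝ) / 2) := by
    rw [Real.sqrt_eq_rpow, ← Real.rpow_natCast, ← Real.rpow_mul hk.le]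
    congr 1; ring
  have e3 : (y ^ (n + 2)) ^ s = y ^ (((n : ℝ) + 2) * s) := by
    rw [← Real.rpow_natCast, ← Real.rpow_mul hk.le]
    push_cast
    rfl
  rw [e1, Real.sqrt_mul (by positivity), mul_pow (64 * (n : ℝ)) y,
    Real.mul_rpow (by positivity) (by positivity),
    e2, e3, Real.rpow_sub hk]
  field_simp

theorem theorem2 (n : ℕ) (hn : 2 ≤ n) :
    ∃ a b C : ℝ, 0 < a ∧ a < b ∧ 0 < C ∧
      ∀ s : ℝ, s < (n : ℝ) / (2 * ((n : ℝ) + 2)) →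
        ∃ (R : ℕ → ℝ) (v : ℕ → L2Space n),
          (∀ k, 0 < R k) ∧ Tendsto R atTop atTop ∧
          (∀ k, v k ≠ 0) ∧ (∀ k, FourierSupportedInAnnulus (v k) a b) ∧
          Tendsto
            (fun k =>
              eLpNorm (schrodingerMaximal (v k) (C * R k)) 2
                  (volume.restrict (Metric.ball (0 : EuclideanSpace ℝ (Fin n)) (R k))) /
                ENNReal.ofReal (R k ^ s * ‖v k‖))
            atTop (𝓝 ∞) := by
  have hn0 : 0 < n := by omega
  have hn' : (2 : ℝ) ≤ n := by exact_mod_cast hn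
  refine ⟨1, 3 * n, 1, one_pos, by linarith, one_pos, fun s hs => ?_⟩
  choose v hv0 hv hratio using fun k : ℕ => exists_maximal_ratio_ge hn0 s (k + 1) k.succ_pos
  refine ⟨fun k => (64 * n * (k + 1 : ℕ) : ℝ) ^ (n + 2), v, fun k => by positivity, ?_, hv0, hv, ?_⟩
  · refine (tendsto_pow_atTop (by omega)).comp (Tendsto.const_mul_atTop (by positivity) ?_)
    exact tendsto_natCast_atTop_atTop.comp (tendsto_add_atTop_nat 1)
  · have hW : 0 < volume.real (Metric.ball (0 : EuclideanSpace ℝ (Fin n)) 1) :=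
      ENNReal.toReal_pos (Metric.measure_ball_pos volume _ one_pos).ne'
        Metric.isBounded_ball.measure_lt_top.ne
    refine tendsto_nhds_top_mono (ENNReal.tendsto_ofReal_atTop.comp
      (tendsto_maximal_ratio_lower_bound hn0 (Real.sqrt_pos.2 hW) hs))
      (Eventually.of_forall fun k => ?_)
    simpa only [one_mul, Function.comp_apply] using hratio k
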